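/- Let $p$ be a prime number, $k$ a perfect field of characteristic $p$, $e\ge 1$ and $r\ge 0$ integers, $\mathfrak S_1=k[[u]]$, $\mathcal X=k((u))$, and $\phi$ the absolute Frobenius $a\mapsto a^p$. Let $\mathcal X^{\mathrm{sep}}$ be a separable closure of $\mathcal X$, $\mathcal O$ the integral closure of $\mathfrak S_1$ in $\mathcal X^{\mathrm{sep}}$, $v$ the unique extension to $\mathcal X^{\mathrm{sep}}$ of the $u$-adic valuation of $\mathcal X$ normalized by $v(u)=1$, and $m^{\ge i}=\{x\in\mathcal O : v(x)\ge i\}$ for $i\in\mathbb Q$. Let $\mathfrak M$ be an object of $\mathrm{Mod}^{r,\phi}_{/\mathfrak S_1}$, that is, a free $\mathfrak S_1$-module of finite rank with a $\phi$-semilinear map $\phi_{\mathfrak M}:\mathfrak M\to\mathfrak M$ such that the cokernel of $1\otimes\phi_{\mathfrak M}:\mathfrak S_1\otimes_{\phi,\mathfrak S_1}\mathfrak M\to\mathfrak M$ is killed by $u^{er}$. Let $\mathcal H(\mathfrak M)$ be the associated finite flat group scheme over $\mathfrak S_1$, whose group of points in an $\mathfrak S_1$-algebra $A$ is the group $\mathrm{Hom}_{\mathfrak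 S_1,\phi}(\mathfrak M,A)$ of the $\mathfrak S_1$-linear maps $f:\mathfrak M\to A$ with $f(\phi_{\mathfrak M}(m))=f(m)^p$ for all $m$. For $i\in\mathbb Q_{\ge 0}$ let the $i$-th lower ramification subgroup $\mathcal H(\mathfrak M)_i$ be the scheme-theoretic closure in $\mathcal H(\mathfrak M)$ of the subgroup $$\mathrm{Ker}\bigl(\mathcal H(\mathfrak M)(\mathcal O)\to\mathcal H(\mathfrak M)(\mathcal O/m^{\ge i})\bigr).$$ Then $\mathcal H(\mathfrak M)_i=0$ for every rational $i>er/(p-1)$: this kernel is zero, and $\mathcal H(\mathfrak M)_i$ is the trivial closed subgroup scheme of $\mathcal H(\mathfrak M)$. -/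

import Mathlib

open PowerSeries LaurentSeries

/-! Throughout, `k⟦X⟧` is the ring `𝔖₁ = k[[u]]` and `k⸨X⸩` is its fraction field `𝒳 = k((u))`; the
variable `u` is written `X`. -/

namespace KisinModules

section Valuation

variable {k : Type*} [Field k]

theorem laurent_valued_eq (f : k⸨X⸩) (hf : f ≠ 0) : Valued.v f = WithZero.exp (-f.order) := by
  apply le_antisymm
  · rw [LaurentSeries.valuation_le_iff_coeff_lt_eq_zero]
    intro n hn
    exact HahnSeries.coeff_eq_zero_of_lt_order hn
  · by_contra h
    push Not at h
    have h2 : Valued.v f ≤ WithZero.exp (-(f.order + 1)) := by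
      have h0 : Valued.v f ≠ 0 := (Valuation.ne_zero_iff _).2 hf
      rw [← WithZero.exp_log h0] at h ⊢
      rw [WithZero.exp_lt_exp] at h
      rw [WithZero.exp_le_exp]
      omega
    rw [LaurentSeries.valuation_le_iff_coeff_lt_eq_zero] at h2
    exact hf (HahnSeries.coeff_order_eq_zero.1 (h2 f.order (by omega)))

theorem laurent_rankOne :
    Nonempty (Valuation.RankOne (Valued.v : Valuation k⸨X⸩ (WithZero (Multiplicative ℤ)))) := by
  have : (Valued.v : Valuation k⸨X⸩ (WithZero (Multiplicative ℤ))).IsNontrivial := by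
    refine ⟨HahnSeries.single 1 1, ?_, ?_⟩
    · rw [Valuation.ne_zero_iff]; simp
    · rw [laurent_valued_eq _ (by simp), HahnSeries.order_single one_ne_zero]
      decide
  rw [Valuation.nonempty_rankOne_iff_mulArchimedean]
  infer_instance

variable {L : Type*} [Field L] [Algebra k⸨X⸩ L]

open scoped Classical in
/-- The valuation of an algebraic extension `L` of `k((u))`, normalized by `u ↦ 1`, as a function
`L → ℚ ∪ {∞}`. An element `x ≠ 0` with minimal polynomial `T ^ d + ⋯ + a₀` over `k((u))` is sent to
`ord_u(a₀) / d`, which is `ord_u (N x) / [k((u))(x) : k((u))]` with `N` the norm of `k((u))(x)`. -/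
noncomputable def extendedOrder (k : Type*) [Field k] {L : Type*} [Field L] [Algebra k⸨X⸩ L] (x : L) : WithTop ℚ :=
  if x = 0 then ⊤
  else ((((minpoly k⸨X⸩ x).coeff 0).order : ℚ) / ((minpoly k⸨X⸩ x).natDegree : ℚ) : ℚ)

theorem exists_multiplicative_norm [Algebra.IsAlgebraic k⸨X⸩ L] :
    ∃ (s : L → ℝ) (c : ℝ), 0 < c ∧ c < 1 ∧ (∀ x y, s (x * y) = s x * s y) ∧
      (∀ x y, s (x + y) ≤ max (s x) (s y)) ∧
      ∀ x, x ≠ 0 → s x = c ^ ((((minpoly k⸨X⸩ x).coeff 0).order : ℝ) /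
        ((minpoly k⸨X⸩ x).natDegree : ℝ)) := by
  obtain ⟨h⟩ := laurent_rankOne (k := k)
  let _ := h
  let N : NontriviallyNormedField k⸨X⸩ :=
    Valued.toNontriviallyNormedField k⸨X⸩ (WithZero (Multiplicative ℤ))
  have hC : @CompleteSpace k⸨X⸩ N.toUniformSpace :=
    LaurentSeries.instLaurentSeriesComplete
  have hU : IsUltrametricDist k⸨X⸩ :=
    Valued.instIsUltrametricDist k⸨X⸩ (WithZero (Multiplicative ℤ))
  have hle : ∀ x y : k⸨X⸩, ‖x‖ ≤ ‖y‖ ↔ Valued.v x ≤ Valued.v y := fun x y =>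
    Valued.toNormedField.norm_le_iff
  have heq : ∀ x y : k⸨X⸩, Valued.v x = Valued.v y → ‖x‖ = ‖y‖ := fun x y hxy =>
    le_antisymm ((hle _ _).2 hxy.le) ((hle _ _).2 hxy.ge)
  let u : k⸨X⸩ := HahnSeries.single 1 1
  have hu : u ≠ 0 := by simp [u]
  have hnorm : ∀ f : k⸨X⸩, f ≠ 0 → ‖f‖ = ‖u‖ ^ f.order := by
    intro f hf
    rw [← norm_zpow]
    apply heq
    rw [map_zpow₀, laurent_valued_eq f hf, laurent_valued_eq u hu,
      HahnSeries.order_single one_ne_zero, ← WithZero.exp_zsmul]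
    simp
  have hu0 : 0 < ‖u‖ := norm_pos_iff.2 hu
  have hu1 : ‖u‖ < 1 := by
    rw [Valued.toNormedField.norm_lt_one_iff, laurent_valued_eq u hu,
      HahnSeries.order_single one_ne_zero]
    decide
  refine ⟨spectralNorm k⸨X⸩ L, ‖u‖, hu0, hu1, fun x y => ?_, fun x y => ?_, fun x hx => ?_⟩
  · exact map_mul (spectralMulAlgNorm k⸨X⸩ L) x y
  · exact isNonarchimedean_spectralNorm x y
  · have h0 : (minpoly k⸨X⸩ x).coeff 0 ≠ 0 :=
      minpoly.coeff_zero_ne_zero (Algebra.IsIntegral.isIntegral x) hx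
    rw [spectralNorm.spectralNorm_eq_norm_coeff_zero_rpow, hnorm _ h0, ← Real.rpow_intCast,
      ← Real.rpow_mul hu0.le, mul_one_div]

theorem extendedOrder_zero : extendedOrder k (0 : L) = ⊤ := if_pos rfl
theorem extendedOrder_of_ne {x : L} (hx : x ≠ 0) : extendedOrder k x =
  ((((minpoly k⸨X⸩ x).coeff 0).order : ℚ) / ((minpoly k⸨X⸩ x).natDegree : ℚ) : ℚ) := if_neg hx

theorem extendedOrder_add [Algebra.IsAlgebraic k⸨X⸩ L] (x y : L) :
    min (extendedOrder k x) (extendedOrder k y) ≤ extendedOrder k (x + y) := by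
  by_cases hx : x = 0
  · simp [hx]
  by_cases hy : y = 0
  · simp [hy]
  by_cases hxy : x + y = 0
  · simp [hxy, extendedOrder_zero]
  obtain ⟨s, c, hc0, hc1, -, hs, he⟩ := exists_multiplicative_norm (k := k) (L := L)
  have h := hs x y
  rw [he x hx, he y hy, he _ hxy, le_max_iff, Real.rpow_le_rpow_left_iff_of_base_lt_one hc0 hc1,
    Real.rpow_le_rpow_left_iff_of_base_lt_one hc0 hc1] at h
  rw [extendedOrder_of_ne hx, extendedOrder_of_ne hy, extendedOrder_of_ne hxy, min_le_iff, WithTop.coe_le_coe,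
    WithTop.coe_le_coe]
  exact_mod_cast h

theorem extendedOrder_mul [Algebra.IsAlgebraic k⸨X⸩ L] (x y : L) :
    extendedOrder k (x * y) = extendedOrder k x + extendedOrder k y := by
  by_cases hx : x = 0
  · simp [hx, extendedOrder_zero]
  by_cases hy : y = 0
  · simp [hy, extendedOrder_zero]
  have hxy : x * y ≠ 0 := mul_ne_zero hx hy
  obtain ⟨s, c, hc0, hc1, hs, -, he⟩ := exists_multiplicative_norm (k := k) (L := L)
  have h := hs x y
  rw [he x hx, he y hy, he _ hxy, ← Real.rpow_add hc0, Real.rpow_right_inj hc0 hc1.ne] at h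
  rw [extendedOrder_of_ne hx, extendedOrder_of_ne hy, extendedOrder_of_ne hxy, ← WithTop.coe_add, WithTop.coe_inj]
  exact_mod_cast h

theorem extendedOrder_algebraMap (f : k⸨X⸩) (hf : f ≠ 0) :
    extendedOrder k (algebraMap k⸨X⸩ L f) = ((f.order : ℚ) : WithTop ℚ) := by
  have : algebraMap k⸨X⸩ L f ≠ 0 := by simpa using hf
  rw [extendedOrder_of_ne this, minpoly.eq_X_sub_C]
  simp

theorem extendedOrder_nonneg {x : L} [Algebra k⟦X⟧ L] [IsScalarTower k⟦X⟧ k⸨X⸩ L]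
    (hx : IsIntegral k⟦X⟧ x) : 0 ≤ extendedOrder k x := by
  by_cases h0 : x = 0
  · simp [h0, extendedOrder_zero]
  rw [extendedOrder_of_ne h0, minpoly.isIntegrallyClosed_eq_field_fractions' k⸨X⸩ hx,
    Polynomial.coeff_map, ← WithTop.coe_zero, WithTop.coe_le_coe]
  apply div_nonneg _ (Nat.cast_nonneg _)
  have : (0 : ℤ) ≤ (algebraMap k⟦X⟧ k⸨X⸩ ((minpoly k⟦X⟧ x).coeff 0)).order := by
    by_cases hz : algebraMap k⟦X⟧ k⸨X⸩ ((minpoly k⟦X⟧ x).coeff 0) = 0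
    · simp [hz]
    rw [LaurentSeries.coe_algebraMap] at hz ⊢
    rw [HahnSeries.ofPowerSeries_apply] at hz ⊢
    by_contra hneg
    push Not at hneg
    refine hz (HahnSeries.coeff_order_eq_zero.1 ?_)
    apply HahnSeries.embDomain_of_notMem_range
    rintro ⟨n, hn⟩
    have hn' : (n : ℤ) = _ := hn
    omega
  exact_mod_cast this

variable (k L) in
/-- `extendedOrder` as an (additive) valuation. -/
noncomputable def valuation [Algebra.IsAlgebraic k⸨X⸩ L] : AddValuation L (WithTop ℚ) :=
  AddValuation.of (extendedOrder k) extendedOrder_zero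
    (by simpa using extendedOrder_algebraMap (k := k) (L := L) 1 one_ne_zero)
    extendedOrder_add extendedOrder_mul

variable (k L) in
/-- The ring of integers of an algebraic extension `L` of `k((u))`: the integral closure of
`k[[u]]` in `L`. -/
noncomputable abbrev ringOfIntegers [Algebra k⟦X⟧ L] : Subalgebra k⟦X⟧ L := integralClosure k⟦X⟧ L

variable (k L) in
/-- The ideal `m_L^{≥ i}` of the elements of valuation `≥ i` in the ring of integers of `L`. -/
noncomputable def idealGE [Algebra.IsAlgebraic k⸨X⸩ L] [Algebra k⟦X⟧ L]
    [IsScalarTower k⟦X⟧ k⸨X⸩ L] (i : ℚ) : Ideal (ringOfIntegers k L) where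
  carrier := {x | (i : WithTop ℚ) ≤ valuation k L (x : L)}
  zero_mem' := by simp
  add_mem' {x y} hx hy := le_trans (le_min hx hy) ((valuation k L).map_add _ _)
  smul_mem' a x hx := by
    have ha : 0 ≤ valuation k L (a : L) := extendedOrder_nonneg a.2
    simp only [Set.mem_ofPred_eq, smul_eq_mul, MulMemClass.coe_mul, AddValuation.map_mul] at hx ⊢
    simpa using add_le_add ha hx

end Valuation

section Group

variable (p : ℕ) [Fact p.Prime] (k : Type*) [Field k] [CharP k p]

instance charP_powerSeries : CharP k⟦X⟧ p :=
  charP_of_injective_algebraMap (algebraMap k k⟦X⟧).injective p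

/-- An object of the category `Mod^{r,φ}_{/𝔖₁}`: a free module `M` of finite rank over
`𝔖₁ = k[[u]]` with a map `φ : M → M` which is semilinear over the absolute Frobenius of `𝔖₁`, such
that the cokernel of `1 ⊗ φ : 𝔖₁ ⊗_{φ,𝔖₁} M → M` is killed by `u ^ (e r)`. The image of `1 ⊗ φ` is
the submodule spanned by the image of `φ`. -/
structure KisinModule (e r : ℕ) (M : Type*) [AddCommGroup M] [Module k⟦X⟧ M] where
  free : Module.Free k⟦X⟧ M
  finite : Module.Finite k⟦X⟧ M
  φ : M →ₛₗ[frobenius k⟦X⟧ p] M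
  coker_killed : ∀ c : M ⧸ Submodule.span k⟦X⟧ (Set.range φ), (X : k⟦X⟧) ^ (e * r) • c = 0

variable {p k} {e r : ℕ} {M : Type*} [AddCommGroup M] [Module k⟦X⟧ M]
  (𝔐 : KisinModule p k e r M)

namespace KisinModule

/-- The group `ℋ(𝔐)(A) = Hom_{𝔖₁,φ}(𝔐, A)` of points of `ℋ(𝔐)` in a `k[[u]]`-algebra `A`, on which
`φ` acts by the absolute Frobenius `a ↦ a ^ p`. -/
noncomputable def points (A : Type*) [CommRing A] [Algebra k⟦X⟧ A] : AddSubgroup (M →ₗ[k⟦X⟧] A) where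
  carrier := {f | ∀ m, f (𝔐.φ m) = f m ^ p}
  zero_mem' m := by simp [(Fact.out : p.Prime).ne_zero]
  add_mem' {f g} hf hg m := by
    have hp : (p : A) = 0 := by
      rw [← map_natCast (algebraMap k⟦X⟧ A), CharP.cast_eq_zero, map_zero]
    obtain ⟨c, hc⟩ := exists_add_pow_prime_eq (Fact.out : p.Prime) (f m) (g m)
    rw [LinearMap.add_apply, LinearMap.add_apply, hf, hg, hc, hp]
    ring
  neg_mem' {f} hf m := by
    have hp : (p : A) = 0 := by
      rw [← map_natCast (algebraMap k⟦X⟧ A), CharP.cast_eq_zero, map_zero]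
    obtain ⟨c, hc⟩ := exists_add_pow_prime_eq (Fact.out : p.Prime) (f m) (-f m)
    rw [add_neg_cancel, hp, zero_pow (Fact.out : p.Prime).ne_zero] at hc
    rw [LinearMap.neg_apply, LinearMap.neg_apply, hf]
    linear_combination hc

/-- The homomorphism `ℋ(𝔐)(A) → ℋ(𝔐)(B)` induced by a homomorphism of `k[[u]]`-algebras
`A → B`. -/
noncomputable def pointsMap {A B : Type*} [CommRing A] [Algebra k⟦X⟧ A] [CommRing B] [Algebra k⟦X⟧ B]
    (g : A →ₐ[k⟦X⟧] B) : 𝔐.points A →+ 𝔐.points B where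
  toFun f := ⟨g.toLinearMap ∘ₗ f.1, fun m => by
    have := f.2 m
    simp [this]⟩
  map_zero' := by ext; simp
  map_add' f f' := by ext; simp

/-- The ideal of relations `m ^ p = φ(m)`, for `m ∈ 𝔐`, in the symmetric algebra of `𝔐`. -/
noncomputable def relations : Ideal (SymmetricAlgebra k⟦X⟧ M) :=
  Ideal.span (Set.range fun m : M =>
    SymmetricAlgebra.ι k⟦X⟧ M m ^ p - SymmetricAlgebra.ι k⟦X⟧ M (𝔐.φ m))

/-- The affine algebra of `ℋ(𝔐)`: the quotient of the symmetric algebra of `𝔐` by the relations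
`m ^ p = φ(m)`. In terms of a basis `e₁, …, e_d` of `𝔐` with `φ(e_i) = ∑_j a_{j,i} e_j`, it is
`k[[u]][X₁, …, X_d] / (X_i ^ p - ∑_j a_{j,i} X_j)`. -/
abbrev affineAlgebra : Type _ := SymmetricAlgebra k⟦X⟧ M ⧸ 𝔐.relations

theorem lift_relations {A : Type*} [CommRing A] [Algebra k⟦X⟧ A] (f : 𝔐.points A)
    (a : SymmetricAlgebra k⟦X⟧ M) (ha : a ∈ 𝔐.relations) : SymmetricAlgebra.lift f.1 a = 0 := by
  refine (Ideal.span_le (I := RingHom.ker (SymmetricAlgebra.lift f.1))).2 ?_ ha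
  rintro _ ⟨m, rfl⟩
  have := f.2 m
  simp [RingHom.mem_ker, this]

/-- The affine algebra represents `ℋ(𝔐)`: a point `f ∈ ℋ(𝔐)(A)` is the same as a homomorphism of
`k[[u]]`-algebras from the affine algebra to `A`. -/
noncomputable def pointsEquiv (A : Type*) [CommRing A] [Algebra k⟦X⟧ A] :
    𝔐.points A ≃ (𝔐.affineAlgebra →ₐ[k⟦X⟧] A) where
  toFun f := Ideal.Quotient.liftₐ 𝔐.relations (SymmetricAlgebra.lift f.1) (𝔐.lift_relations f)
  invFun g := ⟨(g.comp (Ideal.Quotient.mkₐ k⟦X⟧ 𝔐.relations)).toLinearMap ∘ₗ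
      SymmetricAlgebra.ι k⟦X⟧ M, fun m => by
    simp only [LinearMap.comp_apply, AlgHom.toLinearMap_apply, AlgHom.comp_apply]
    rw [← map_pow, ← map_pow]
    congr 1
    exact ((Ideal.Quotient.eq (I := 𝔐.relations)).2
      (Ideal.subset_span (Set.mem_range_self m))).symm⟩
  left_inv f := by
    ext m
    exact SymmetricAlgebra.lift_ι_apply f.1 m
  right_inv g := by
    apply Ideal.Quotient.algHom_ext
    apply SymmetricAlgebra.algHom_ext
    ext m
    exact SymmetricAlgebra.lift_ι_apply _ m

section LowerRamification

variable (Ω : Type*) [Field Ω] [Algebra k⸨X⸩ Ω] [Algebra.IsAlgebraic k⸨X⸩ Ω] [Algebra k⟦X⟧ Ω]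
  [IsScalarTower k⟦X⟧ k⸨X⸩ Ω]

/-- The subgroup `Ker(ℋ(𝔐)(𝒪_Ω) → ℋ(𝔐)(𝒪_Ω / m_Ω^{≥ i}))` of `ℋ(𝔐)(𝒪_Ω)`. -/
noncomputable def lowerRamificationPoints (i : ℚ) : AddSubgroup (𝔐.points (ringOfIntegers k Ω)) :=
  (𝔐.pointsMap (B := ringOfIntegers k Ω ⧸ idealGE k Ω i) (Ideal.Quotient.mkₐ k⟦X⟧ (idealGE k Ω i))).ker

/-- The ideal of the affine algebra of `ℋ(𝔐)` which defines the `i`-th lower ramification subgroup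
`ℋ(𝔐)_i`, the scheme-theoretic closure in `ℋ(𝔐)` of the subgroup `lowerRamificationPoints` of
`ℋ(𝔐)(𝒪_Ω)`: it consists of the functions on `ℋ(𝔐)` vanishing at all points of that subgroup. -/
noncomputable def lowerRamificationIdeal (i : ℚ) : Ideal 𝔐.affineAlgebra :=
  ⨅ x ∈ 𝔐.lowerRamificationPoints Ω i, RingHom.ker (𝔐.pointsEquiv (ringOfIntegers k Ω) x)

/-- The ideal of the affine algebra of `ℋ(𝔐)` which defines the trivial closed subgroup scheme: the
kernel of the homomorphism to `k[[u]]` corresponding to `0 ∈ ℋ(𝔐)(k[[u]])`. -/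
noncomputable def augmentationIdeal : Ideal 𝔐.affineAlgebra :=
  RingHom.ker (𝔐.pointsEquiv k⟦X⟧ 0)

end LowerRamification

end KisinModule

end Group

end KisinModules

/-! ### Valuation estimates in the ring of integers. -/

namespace KisinModules

/-! Let `f` be a point all of whose values have valuation at least `i`. Frobenius compatibility
gives `f (φ m) = f m ^ p`, of valuation at least `p * i`. Since `u ^ (e * r)` carries `M` into the
span of the image of `φ`, every `f m` has valuation at least `p * i - e * r`
(`lowerRamificationPoints_le`). The map `i ↦ p * i - e * r` fixes `c = e * r / (p - 1)` and
multiplies the distance to `c` by `p`. Starting from `i > c`, the bounds tend to infinity, so `f =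
0` (`lowerRamificationPoints_eq_bot`). The closure is then cut out by the kernel of the zero point
alone, which is the augmentation ideal because `k⟦X⟧` embeds in the ring of integers. -/

theorem valuation_X {k L : Type*} [Field k] [Field L] [Algebra k⸨X⸩ L]
    [Algebra.IsAlgebraic k⸨X⸩ L] [Algebra k⟦X⟧ L] [IsScalarTower k⟦X⟧ k⸨X⸩ L] :
    valuation k L (algebraMap k⟦X⟧ L X) = ((1 : ℚ) : WithTop ℚ) := by
  have hX : algebraMap k⟦X⟧ k⸨X⸩ X = HahnSeries.single 1 1 := by
    rw [LaurentSeries.coe_algebraMap]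
    simp
  have h := extendedOrder_algebraMap (k := k) (L := L) (HahnSeries.single 1 1) (by simp)
  rw [HahnSeries.order_single one_ne_zero] at h
  rw [IsScalarTower.algebraMap_apply k⟦X⟧ k⸨X⸩ L, hX]
  exact h.trans (by simp)

theorem mem_idealGE {k L : Type*} [Field k] [Field L] [Algebra k⸨X⸩ L]
    [Algebra.IsAlgebraic k⸨X⸩ L] [Algebra k⟦X⟧ L] [IsScalarTower k⟦X⟧ k⸨X⸩ L] {i : ℚ}
    {x : ringOfIntegers k L} :
    x ∈ idealGE k L i ↔ (i : WithTop ℚ) ≤ valuation k L (x : L) := Iff.rfl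

theorem pow_mem_idealGE {k L : Type*} [Field k] [Field L] [Algebra k⸨X⸩ L]
    [Algebra.IsAlgebraic k⸨X⸩ L] [Algebra k⟦X⟧ L] [IsScalarTower k⟦X⟧ k⸨X⸩ L] {i : ℚ}
    {x : ringOfIntegers k L} (hx : x ∈ idealGE k L i) (n : ℕ) :
    x ^ n ∈ idealGE k L (n * i) := by
  rw [mem_idealGE] at hx ⊢
  rw [SubmonoidClass.coe_pow, AddValuation.map_pow]
  calc (((n * i : ℚ)) : WithTop ℚ) = n • (i : WithTop ℚ) := by
        rw [← nsmul_eq_mul]; exact WithTop.coe_nsmul _ _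
    _ ≤ _ := nsmul_le_nsmul_right hx n

/-- Division by `u ^ n` costs exactly `n`, as `u` has valuation 1. A negative `i - n` is harmless:
the ideal is then the whole ring. -/
theorem mem_idealGE_of_X_pow_smul_mem {k L : Type*} [Field k] [Field L] [Algebra k⸨X⸩ L]
    [Algebra.IsAlgebraic k⸨X⸩ L] [Algebra k⟦X⟧ L] [IsScalarTower k⟦X⟧ k⸨X⸩ L] {i : ℚ} {n : ℕ}
    {x : ringOfIntegers k L} (hx : (X : k⟦X⟧) ^ n • x ∈ idealGE k L i) :
    x ∈ idealGE k L (i - n) := by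
  rw [mem_idealGE] at hx ⊢
  rw [Algebra.smul_def, MulMemClass.coe_mul, AddValuation.map_mul,
    Subalgebra.coe_algebraMap, map_pow, AddValuation.map_pow, valuation_X,
    ← WithTop.coe_nsmul, nsmul_one] at hx
  generalize valuation k L (x : L) = v at hx ⊢
  induction v with
  | top => exact le_top
  | coe v =>
    rw [← WithTop.coe_add, WithTop.coe_le_coe] at hx
    rw [WithTop.coe_le_coe]
    linarith

theorem eq_zero_of_forall_mem_idealGE {k L : Type*} [Field k] [Field L] [Algebra k⸨X⸩ L]
    [Algebra.IsAlgebraic k⸨X⸩ L] [Algebra k⟦X⟧ L] [IsScalarTower k⟦X⟧ k⸨X⸩ L]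
    {x : ringOfIntegers k L} (hx : ∀ N : ℕ, ∃ i : ℚ, N ≤ i ∧ x ∈ idealGE k L i) : x = 0 := by
  have htop : valuation k L (x : L) = ⊤ := by
    rw [WithTop.eq_top_iff_forall_ge]
    intro a
    obtain ⟨N, hN⟩ := exists_nat_ge a
    obtain ⟨i, hNi, hi⟩ := hx N
    exact (WithTop.coe_le_coe.2 (hN.trans hNi)).trans hi
  exact Subtype.ext ((AddValuation.top_iff _).1 htop)

/-! ### Vanishing of the ramification points. -/

namespace KisinModule

variable {p : ℕ} [Fact p.Prime] {k : Type*} [Field k] [CharP k p] {e r : ℕ} {M : Type*}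
  [AddCommGroup M] [Module k⟦X⟧ M] (𝔐 : KisinModule p k e r M)

theorem X_pow_smul_mem_span (m : M) :
    (X : k⟦X⟧) ^ (e * r) • m ∈ Submodule.span k⟦X⟧ (Set.range 𝔐.φ) := by
  rw [← Submodule.Quotient.mk_eq_zero, Submodule.Quotient.mk_smul]
  exact 𝔐.coker_killed _

section LowerRamification

variable {Ω : Type*} [Field Ω] [Algebra k⸨X⸩ Ω] [Algebra.IsAlgebraic k⸨X⸩ Ω] [Algebra k⟦X⟧ Ω]
  [IsScalarTower k⟦X⟧ k⸨X⸩ Ω]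

theorem mem_lowerRamificationPoints {i : ℚ} {f : 𝔐.points (ringOfIntegers k Ω)} :
    f ∈ 𝔐.lowerRamificationPoints Ω i ↔ ∀ m, f.1 m ∈ idealGE k Ω i := by
  rw [lowerRamificationPoints, AddMonoidHom.mem_ker, Subtype.ext_iff, LinearMap.ext_iff]
  exact forall_congr' fun m => Ideal.Quotient.eq_zero_iff_mem

/-- The engine of the proof: Frobenius multiplies the bound by `p`, and the cokernel condition loses
at most `e * r`. -/
theorem lowerRamificationPoints_le (i : ℚ) :
    𝔐.lowerRamificationPoints Ω i ≤ 𝔐.lowerRamificationPoints Ω (p * i - (e * r : ℕ)) := by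
  intro f hf
  rw [mem_lowerRamificationPoints] at hf ⊢
  intro m
  apply mem_idealGE_of_X_pow_smul_mem
  rw [← map_smul]
  -- The elements that `f` sends into an ideal form a submodule, so it is enough to check the
  -- generators `φ m`.
  have hle : Submodule.span k⟦X⟧ (Set.range 𝔐.φ) ≤
      ((idealGE k Ω (p * i)).restrictScalars k⟦X⟧).comap f.1 := by
    rw [Submodule.span_le]
    rintro _ ⟨m, rfl⟩
    change f.1 (𝔐.φ m) ∈ idealGE k Ω (p * i)
    rw [f.2 m]
    exact pow_mem_idealGE (hf m) p
  exact hle (𝔐.X_pow_smul_mem_span m)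

theorem lowerRamificationPoints_eq_bot {i : ℚ} (hi : (e * r : ℚ) / (p - 1) < i) :
    𝔐.lowerRamificationPoints Ω i = ⊥ := by
  have hp : (1 : ℚ) < p := by exact_mod_cast (Fact.out : p.Prime).one_lt
  have hp' : (p : ℚ) - 1 ≠ 0 := (sub_pos.2 hp).ne'
  set c : ℚ := (e * r : ℚ) / (p - 1) with hc
  have hcp : (e * r : ℚ) = c * (p - 1) := by rw [hc]; field_simp
  have hc0 : 0 ≤ c := div_nonneg (by positivity) (sub_pos.2 hp).le
  rw [eq_bot_iff]
  intro f hf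
  -- Closed form of the `n`-th iterate of `i ↦ p * i - e * r`, written around its fixed point `c`.
  have hiter : ∀ n : ℕ, f ∈ 𝔐.lowerRamificationPoints Ω (p ^ n * (i - c) + c) := by
    intro n
    induction n with
    | zero => simpa using hf
    | succ n ih =>
      convert 𝔐.lowerRamificationPoints_le _ ih using 2
      push_cast
      rw [hcp]
      ring
  rw [AddSubgroup.mem_bot]
  ext m : 2
  refine eq_zero_of_forall_mem_idealGE fun N => ?_
  obtain ⟨n, hn⟩ := pow_unbounded_of_one_lt (N / (i - c)) hp
  refine ⟨_, ?_, (𝔐.mem_lowerRamificationPoints.1 (hiter n)) m⟩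
  -- The choice of `n` gives `N < p ^ n * (i - c)`; adding `c ≥ 0` keeps the bound.
  rw [div_lt_iff₀ (sub_pos.2 hi)] at hn
  linarith

/-! ### The scheme-theoretic closure. -/

/-- The zero point over `A` factors through the zero point over `k⟦X⟧`, and composing with an
injection does not change the kernel. -/
theorem ker_pointsEquiv_zero (A : Type*) [CommRing A] [Algebra k⟦X⟧ A]
    (hA : Function.Injective (algebraMap k⟦X⟧ A)) :
    RingHom.ker (𝔐.pointsEquiv A 0) = 𝔐.augmentationIdeal := by
  have h : 𝔐.pointsEquiv A 0 = (Algebra.ofId k⟦X⟧ A).comp (𝔐.pointsEquiv k⟦X⟧ 0) := by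
    apply (𝔐.pointsEquiv A).symm.injective
    rw [Equiv.symm_apply_apply]
    ext m
    have hz : 𝔐.pointsEquiv k⟦X⟧ 0
        (Ideal.Quotient.mkₐ k⟦X⟧ 𝔐.relations (SymmetricAlgebra.ι k⟦X⟧ M m)) = 0 :=
      SymmetricAlgebra.lift_ι_apply _ m
    change 0 = Algebra.ofId k⟦X⟧ A (𝔐.pointsEquiv k⟦X⟧ 0
      (Ideal.Quotient.mkₐ k⟦X⟧ 𝔐.relations (SymmetricAlgebra.ι k⟦X⟧ M m)))
    rw [hz, map_zero]
  ext a
  rw [augmentationIdeal, RingHom.mem_ker, RingHom.mem_ker, h, AlgHom.comp_apply]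
  exact map_eq_zero_iff _ hA

theorem lowerRamificationIdeal_eq_augmentationIdeal {i : ℚ}
    (h : 𝔐.lowerRamificationPoints Ω i = ⊥) :
    𝔐.lowerRamificationIdeal Ω i = 𝔐.augmentationIdeal := by
  have hinj : Function.Injective (algebraMap k⟦X⟧ (ringOfIntegers k Ω)) := by
    apply Function.Injective.of_comp (f := algebraMap (ringOfIntegers k Ω) Ω)
    rw [← RingHom.coe_comp, ← IsScalarTower.algebraMap_eq,
      IsScalarTower.algebraMap_eq k⟦X⟧ k⸨X⸩ Ω, RingHom.coe_comp]
    exact (algebraMap k⸨X⸩ Ω).injective.comp (IsFractionRing.injective k⟦X⟧ k⸨X⸩)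
  rw [lowerRamificationIdeal, h, ← 𝔐.ker_pointsEquiv_zero _ hinj]
  -- The intersection defining the closure has a single term, the kernel at the point 0.
  simp only [AddSubgroup.mem_bot, iInf_iInf_eq_left]

end LowerRamification

end KisinModule

end KisinModules

theorem corollary3p5 (p : ℕ) [Fact p.Prime] (k : Type*) [Field k] [CharP k p] [PerfectField k]
    (Ω : Type*) [Field Ω] [Algebra k⸨X⸩ Ω] [IsSepClosure k⸨X⸩ Ω]
    [Algebra k⟦X⟧ Ω] [IsScalarTower k⟦X⟧ k⸨X⸩ Ω]
    (e r : ℕ) (he : 1 ≤ e) (M : Type*) [AddCommGroup M] [Module k⟦X⟧ M]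
    (𝔐 : KisinModules.KisinModule p k e r M) (i : ℚ)
    (hi : (e * r : ℚ) / (p - 1) < i) :
    𝔐.lowerRamificationPoints Ω i = ⊥ ∧
      𝔐.lowerRamificationIdeal Ω i = 𝔐.augmentationIdeal := by
  have h := 𝔐.lowerRamificationPoints_eq_bot (Ω := Ω) hi
  exact ⟨h, 𝔐.lowerRamificationIdeal_eq_augmentationIdeal h⟩
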